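/- Let $m,n\ge 1$. The Fisher graph is the honeycomb lattice with every vertex replaced by a triangle; let $G$ be its quotient by $n$ translations in the first and $m$ translations in the second lattice direction, embedded in the torus $\mathbb{T}$ (so $G$ has $6mn$ vertices and $9mn$ edges, and its faces are $2mn$ triangles and $mn$ dodecagons). Give the edges arbitrary positive weights $W(e)$ and a translation-invariant orientation (for example a translation-invariant clockwise-odd one). Let $\gamma_x$ (resp. $\gamma_y$) be the closed dual path that crosses the $m$ non-triangle edges (resp. the $n$ non-triangle edges) joining the last column (resp. row) of fundamental cells to the first one. Define the matrix $K(z,w)$, indexed by the vertices, as follows: if the edge $e=uv$ is oriented from $u$ to $v$ then $K_{u,v}=W(e)$ and $K_{v,u}=-W(e)$, and if moreover $e$ is crossed by $\gamma_x$ (resp. $\gamma_y$) then $K_{u,v}$ is multiplied by $z$ (resp. $w$) and $K_{v,u}$ by $1/z$ (resp. $1/w$); all other entries are $0$. Let $P(z,w)=\det K(z,w)$, a Laurent polynomial. A loop configuration $C$ is an assignment of multiplicities in $\mathbb{Z}_{\ge 0}$ to the edges of $G$ that occupies each vertex exactly twice; its loops are the connected components of the set of occupied edges (each is a cycle, or a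 doubled edge, which counts as a loop with two vertices), and a loop is odd if it has an odd number of vertices. For a configuration $C$ let $$P_C(z,w)=\sum_{\sigma}\operatorname{sgn}(\sigma)\prod_{v}K_{v,\sigma(v)}(z,w),$$ the sum being over all permutations $\sigma$ of the vertices whose steps $v\mapsto\sigma(v)$ use each edge (in either direction) exactly as often as its multiplicity in $C$, that is, over all orientations of $C$. Then $P(z,w)=\sum_C P_C(z,w)$. Moreover, for every loop configuration $C$ whose contribution does not cancel, i.e. $P_C(z,w)\neq 0$ as a Laurent polynomial, every odd loop of $C$ is homologically nontrivial (traversed once, it has a nonzero class in $H_1(\mathbb{T};\mathbb{Z})$), and the number of odd loops of $C$ is even. -/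

import Mathlib

section

open scoped Classical

/-- The cells of the `ℤ²`-periodic Fisher graph, modulo `n` translations in the `z`-direction (first
coordinate) and `m` translations in the `w`-direction (second coordinate). -/
abbrev FisherCell (n m : ℕ) : Type := ZMod n × ZMod m

/-- Vertices of the toroidal Fisher graph. A cell `(x, y)` of the honeycomb lattice has two
honeycomb vertices, of type `false` and of type `true`; each one is replaced by a triangle with
three corners, numbered `0, 1, 2`. There are `6 * m * n` vertices. -/
abbrev FisherVertex (n m : ℕ) : Type := FisherCell n m × Bool × Fin 3

/-- The nine translation classes of edges of the Fisher graph. `Sum.inl (s, k)` is the side of a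
triangle of type `s` between its corners `k` and `k + 1` (modulo 3). `Sum.inr k` is an edge
between two triangles; `k = 0, 1, 2` are the `a`-, `b`- and `c`-edges. -/
abbrev FisherEdgeClass : Type := (Bool × Fin 3) ⊕ Fin 3

/-- The `9 * m * n` edges of the toroidal Fisher graph. -/
abbrev FisherEdge (n m : ℕ) : Type := FisherCell n m × FisherEdgeClass

/-- The cell reached from the cell `p` along an `a`-edge (`k = 0`), `b`-edge (`k = 1`) or
`c`-edge (`k = 2`) starting at the triangle of type `false` of `p`. -/
def FisherCell.shift {n m : ℕ} (p : FisherCell n m) : Fin 3 → FisherCell n m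
  | 0 => p
  | 1 => (p.1 + 1, p.2)
  | 2 => (p.1, p.2 + 1)

namespace FisherEdge

variable {n m : ℕ}

/-- First endpoint, for a fixed reference direction of the edge. -/
def src : FisherEdge n m → FisherVertex n m
  | (p, Sum.inl (s, k)) => (p, s, k)
  | (p, Sum.inr k) => (p, false, k)

/-- Second endpoint, for the same reference direction. -/
def dst : FisherEdge n m → FisherVertex n m
  | (p, Sum.inl (s, k)) => (p, s, k + 1)
  | (p, Sum.inr k) => (p.shift k, true, k)

/-- `e` is the edge `{u, v}`, and its reference direction is from `u` to `v`. -/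
def Joins (e : FisherEdge n m) (u v : FisherVertex n m) : Prop := e.src = u ∧ e.dst = v

theorem src_ne_dst (e : FisherEdge n m) : e.src ≠ e.dst := by
  rcases e with ⟨p, ⟨s, k⟩ | k⟩
  · intro h
    have h2 : k = k + 1 := congrArg (fun v : FisherVertex n m => v.2.2) h
    revert h2
    fin_cases k <;> decide
  · intro h
    have h2 : false = true := congrArg (fun v : FisherVertex n m => v.2.1) h
    exact Bool.noConfusion h2

/-- The edges crossed by the horizontal dual path `γ_x`: the `m` many `b`-edges from the last
column of cells to the column `0`. -/
def CrossesX (e : FisherEdge n m) : Prop := e.2 = Sum.inr 1 ∧ e.1.1 + 1 = 0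

/-- The edges crossed by the vertical dual path `γ_y`: the `n` many `c`-edges from the last
row of cells to the row `0`. -/
def CrossesY (e : FisherEdge n m) : Prop := e.2 = Sum.inr 2 ∧ e.1.2 + 1 = 0

end FisherEdge

/-- A translation-invariant orientation of the Fisher graph: one direction for each of the nine
translation classes of edges, `true` for the reference direction, `false` for its reverse. -/
abbrev FisherOrientation : Type := FisherEdgeClass → Bool

namespace FisherOrientation

variable {n m : ℕ}

/-- The oriented edge `e` points away from this vertex. -/
def tail (o : FisherOrientation) (e : FisherEdge n m) : FisherVertex n m :=
  if o e.2 then e.src else e.dst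

/-- The oriented edge `e` points to this vertex. -/
def head (o : FisherOrientation) (e : FisherEdge n m) : FisherVertex n m :=
  if o e.2 then e.dst else e.src

end FisherOrientation

/-- Real Laurent polynomials in two variables `z, w`. -/
abbrev Laurent2 : Type := AddMonoidAlgebra ℝ (ℤ × ℤ)

/-- The monomial `c * z ^ i * w ^ j`. -/
noncomputable def Laurent2.monomial (i j : ℤ) (c : ℝ) : Laurent2 := AddMonoidAlgebra.single (i, j) c

section Expansion

variable {n m : ℕ} [NeZero n] [NeZero m]

/-- The modified Kasteleyn matrix `K(z, w)` of the toroidal Fisher graph with orientation `o` and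
edge weights `W`. If `{u, v}` is an edge `e` oriented from `u` to `v`, then `K u v = W e` and
`K v u = - W e`; moreover `K u v` is multiplied by `z` and `K v u` by `z⁻¹` if `e` is crossed
by `γ_x`, and likewise with `w` for `γ_y`. The graph is simple, so that each sum has at most
one non-zero term; the entry of a non-adjacent pair is `0`. -/
noncomputable def kasteleyn (o : FisherOrientation) (W : FisherEdge n m → ℝ) :
    Matrix (FisherVertex n m) (FisherVertex n m) Laurent2 := fun u v =>
  (∑ e : FisherEdge n m, if o.tail e = u ∧ o.head e = v then
      Laurent2.monomial (if e.CrossesX then 1 else 0) (if e.CrossesY then 1 else 0) (W e) else 0) +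
  (∑ e : FisherEdge n m, if o.tail e = v ∧ o.head e = u then
      Laurent2.monomial (if e.CrossesX then -1 else 0) (if e.CrossesY then -1 else 0) (-W e) else 0)

/-- The characteristic polynomial `P(z, w) = det K(z, w)`. -/
noncomputable def fisherCharPoly (o : FisherOrientation) (W : FisherEdge n m → ℝ) : Laurent2 :=
  (kasteleyn o W).det

variable (n m) in
/-- An (unoriented) loop configuration: a family of edges with multiplicities that occupies each
vertex exactly twice. It consists of disjoint cycles and doubled edges. -/
@[ext]
structure LoopConfig where
  /-- The multiplicity of an edge. -/
  mult : FisherEdge n m → ℕ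
  /-- Each vertex is occupied exactly twice. -/
  occupied_twice : ∀ v, (∑ e : FisherEdge n m, if e.src = v ∨ e.dst = v then mult e else 0) = 2

/-- The number of times that the permutation `σ`, read as the set of steps `v ↦ σ v`, uses the edge
`e`, in either direction. -/
noncomputable def stepCount (σ : Equiv.Perm (FisherVertex n m)) (e : FisherEdge n m) : ℕ :=
  (Finset.univ.filter fun v => e.Joins v (σ v) ∨ e.Joins (σ v) v).card

namespace LoopConfig

theorem mult_le_two (C : LoopConfig n m) (e : FisherEdge n m) : C.mult e ≤ 2 := by
  rw [← C.occupied_twice e.src]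
  refine le_trans (by simp) (Finset.single_le_sum (s := Finset.univ)
    (f := fun e' : FisherEdge n m => if e'.src = e.src ∨ e'.dst = e.src then C.mult e' else 0)
    (fun _ _ => Nat.zero_le _) (Finset.mem_univ e))

instance : Finite (LoopConfig n m) := by
  refine Finite.of_injective
    (fun C : LoopConfig n m => fun e => (⟨C.mult e, Nat.lt_succ_of_le (C.mult_le_two e)⟩ : Fin 3)) ?_
  intro C D h
  ext e
  exact congrArg Fin.val (congrFun h e)

noncomputable instance : Fintype (LoopConfig n m) := Fintype.ofFinite _

/-- The contribution `P_C(z, w)` of the loop configuration `C` to the expansion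
`det K = ∑ σ, sign σ * ∏ v, K v (σ v)`: the sum of the terms of those permutations `σ` (oriented
loop configurations) whose underlying unoriented configuration is `C`. -/
noncomputable def contribution (C : LoopConfig n m) (o : FisherOrientation)
    (W : FisherEdge n m → ℝ) : Laurent2 :=
  ∑ σ : Equiv.Perm (FisherVertex n m), if stepCount σ = C.mult then
    (Equiv.Perm.sign σ : ℤ) • ∏ v, kasteleyn o W v (σ v) else 0

/-- The graph of occupied edges of a configuration. -/
def graph (C : LoopConfig n m) : SimpleGraph (FisherVertex n m) where
  Adj u v := ∃ e : FisherEdge n m, C.mult e ≠ 0 ∧ (e.Joins u v ∨ e.Joins v u)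
  symm := ⟨fun _ _ ⟨e, he, h⟩ => ⟨e, he, h.symm⟩⟩
  loopless := ⟨fun _ ⟨e, _, h⟩ => by
    rcases h with ⟨h1, h2⟩ | ⟨h1, h2⟩ <;> exact e.src_ne_dst (h1.trans h2.symm)⟩

/-- The loops of a configuration: the connected components of the occupied edges. A doubled edge
is a loop with two vertices. -/
abbrev Loop (C : LoopConfig n m) : Type := C.graph.ConnectedComponent

end LoopConfig

end Expansion

section Homology

variable {n m : ℕ}

/-- The faces of the Fisher graph embedded in the torus: `(p, some s)` is the triangle of type
`s` in the cell `p`; `(p, none)` is the dodecagon (from a hexagon of the honeycomb lattice) which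
contains both the `b`-edge and the `c`-edge that start in the cell `p`. -/
abbrev FisherFace (n m : ℕ) : Type := FisherCell n m × Option Bool

/-- The cellular `1`-chain (in terms of the reference directions) of one step from `u` to `v`. -/
noncomputable def stepChain (u v : FisherVertex n m) : FisherEdge n m → ℤ := fun e =>
  (if e.Joins u v then 1 else 0) - (if e.Joins v u then 1 else 0)

/-- The vertices met when going around a face, back to the first one. -/
def FisherFace.circuit : FisherFace n m → List (FisherVertex n m)
  | (p, some s) => [(p, s, 0), (p, s, 1), (p, s, 2), (p, s, 0)]
  | ((x, y), none) =>
    [((x, y), false, 1), ((x + 1, y), true, 1),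
     ((x + 1, y), true, 0), ((x + 1, y), false, 0),
     ((x + 1, y), false, 2), ((x + 1, y + 1), true, 2),
     ((x + 1, y + 1), true, 1), ((x, y + 1), false, 1),
     ((x, y + 1), false, 0), ((x, y + 1), true, 0),
     ((x, y + 1), true, 2), ((x, y), false, 2),
     ((x, y), false, 1)]

/-- The `1`-chain of a path given by the list of its vertices. -/
noncomputable def pathChain (l : List (FisherVertex n m)) : FisherEdge n m → ℤ :=
  ((l.zip l.tail).map fun uv => stepChain uv.1 uv.2).sum

/-- The cellular boundary map from `2`-chains to `1`-chains of the torus, with the cell structure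
given by the embedded Fisher graph. -/
noncomputable def faceBoundary [NeZero n] [NeZero m] (f : FisherFace n m → ℤ) :
    FisherEdge n m → ℤ :=
  ∑ F : FisherFace n m, f F • pathChain F.circuit

/-- A loop of a configuration is homologically nontrivial if, traversed once, it has a nonzero class
in the first integral homology of the torus, that is, its `1`-chain is not a boundary. The two
directions of traversal give opposite classes. -/
def LoopConfig.HomologicallyNontrivial [NeZero n] [NeZero m] (C : LoopConfig n m) (c : C.Loop) :
    Prop :=
  ∃ (u : FisherVertex n m) (p : C.graph.Walk u u), u ∈ c.supp ∧ p.IsCycle ∧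
    ¬ ∃ f : FisherFace n m → ℤ, faceBoundary f = pathChain p.support

end Homology

end

/-! A permutation with a nonzero term in the expansion of `det K(z, w)` moves every vertex along an
edge, so its cycles are the oriented loops of exactly one configuration. Grouping the terms by
configuration gives the formula for `P` (`fisherCharPoly_eq_sum_contribution`).

Reversing one loop of such a permutation keeps the sign of the permutation and, by `kasteleyn_swap`,
multiplies the product by (-1)^length · z^(-2a) · w^(-2b), where a and b are, up to sign, the
crossing numbers of the loop with γ_x and γ_y. Both crossing numbers vanish on face boundaries, so a
= b = 0 on a homologically trivial loop. If that loop is also odd, its reversal is a sign-reversing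
involution on the nonzero terms, and `P_C = 0` (`contribution_eq_zero`).

Evenness needs no cancellation: the number of odd components has the parity of the number of
vertices, 6mn. -/

/-! ### Components of a graph as orbits of a permutation -/

section PermLoops

open scoped Classical
open Function

variable {V : Type*}

/-- The walk `u, f u, f (f u), …` along the iterates of a map whose steps are edges. -/
def SimpleGraph.iterateWalk (G : SimpleGraph V) (f : V → V) (h : ∀ v, G.Adj v (f v)) :
    ∀ (i : ℕ) (u : V), G.Walk u (f^[i] u)
  | 0, _ => .nil
  | i + 1, u => .cons (h u) (SimpleGraph.iterateWalk G f h i (f u))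

theorem SimpleGraph.length_iterateWalk (G : SimpleGraph V) (f : V → V) (h : ∀ v, G.Adj v (f v))
    (i : ℕ) (u : V) : (G.iterateWalk f h i u).length = i := by
  induction i generalizing u with
  | zero => rfl
  | succ i ih => simpa [SimpleGraph.iterateWalk] using ih (f u)

theorem SimpleGraph.support_iterateWalk (G : SimpleGraph V) (f : V → V) (h : ∀ v, G.Adj v (f v))
    (i : ℕ) (u : V) :
    (G.iterateWalk f h i u).support = (List.range (i + 1)).map fun j => f^[j] u := by
  induction i generalizing u with
  | zero => rfl
  | succ i ih =>
    rw [List.range_succ_eq_map]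
    simp [SimpleGraph.iterateWalk, ih, comp_def]

/-- Period 2 must be excluded: it retraces a single edge, which is not a cycle. -/
theorem SimpleGraph.isCycle_iterateWalk (G : SimpleGraph V) (f : V → V) (h : ∀ v, G.Adj v (f v))
    (u : V) (hk : 3 ≤ minimalPeriod f u) :
    ((G.iterateWalk f h (minimalPeriod f u) u).copy rfl (iterate_minimalPeriod)).IsCycle := by
  rw [SimpleGraph.Walk.isCycle_iff_isPath_tail_and_le_length]
  refine ⟨?_, by simpa [SimpleGraph.length_iterateWalk] using hk⟩
  have hs : ((G.iterateWalk f h (minimalPeriod f u) u).copy rfl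
      (iterate_minimalPeriod)).support.tail.Nodup := by
    rw [SimpleGraph.Walk.support_copy, SimpleGraph.support_iterateWalk, List.range_succ_eq_map]
    simp only [List.map_cons, List.tail_cons, List.map_map, comp_def]
    refine List.Nodup.map_on ?_ List.nodup_range
    intro i hi j hj hij
    rw [List.mem_range] at hi hj
    rw [Nat.succ_eq_add_one, Nat.succ_eq_add_one] at hij
    -- The indices in the tail run from 1 to the period. Applying `f` once less than the period
    -- turns `i + 1` into `i`, inside the range where iterates are distinct; injectivity of `f` is
    -- not needed.
    have hp : IsPeriodicPt f (minimalPeriod f u) u := isPeriodicPt_minimalPeriod f u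
    have := congrArg (f^[minimalPeriod f u - 1]) hij
    rw [← iterate_add_apply, ← iterate_add_apply,
      show minimalPeriod f u - 1 + (i + 1) = i + minimalPeriod f u by omega,
      show minimalPeriod f u - 1 + (j + 1) = j + minimalPeriod f u by omega,
      iterate_add_apply, iterate_add_apply, hp] at this
    exact iterate_injOn_Iio_minimalPeriod hi hj this
  rw [SimpleGraph.Walk.isPath_def, SimpleGraph.Walk.support_tail_of_not_nil]
  · exact hs
  · rw [SimpleGraph.Walk.not_nil_iff_lt_length]
    simp only [SimpleGraph.Walk.length_copy, SimpleGraph.length_iterateWalk]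
    omega

variable [Fintype V]

/-- If the edges of a graph are exactly the steps of a permutation, then its components are the
orbits of the permutation. -/
theorem SimpleGraph.filter_mem_supp_eq_image_iterate (G : SimpleGraph V) (σ : Equiv.Perm V)
    (hσ : ∀ v, G.Adj v (σ v)) (hG : ∀ u v, G.Adj u v → σ u = v ∨ σ v = u)
    (c : G.ConnectedComponent) [DecidablePred (· ∈ c.supp)] {u : V} (hu : u ∈ c.supp) :
    (Finset.univ.filter fun v => v ∈ c.supp) =
      (Finset.range (minimalPeriod σ u)).image fun i => σ^[i] u := by
  have hc : G.connectedComponentMk u = c := hu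
  have hpos : 0 < minimalPeriod σ u :=
    minimalPeriod_pos_of_mem_periodicPts (σ.injective.mem_periodicPts u)
  ext v
  simp only [Finset.mem_filter, Finset.mem_univ, true_and, Finset.mem_image, Finset.mem_range]
  constructor
  · intro hv
    have hr : G.Reachable u v :=
      (SimpleGraph.ConnectedComponent.exact (hc.trans (Eq.symm hv)))
    have hs : σ.SameCycle u v := by
      obtain ⟨p⟩ := hr
      clear hc hv hu hpos
      induction p with
      | nil => exact .refl _ _
      | cons h _ ih =>
        refine .trans ?_ ih
        rcases hG _ _ h with rfl | rfl
        · exact (Equiv.Perm.sameCycle_apply_right).2 (.refl _ _)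
        · exact (Equiv.Perm.sameCycle_apply_left).2 (.refl _ _)
    obtain ⟨i, -, hi⟩ := hs.exists_pow_eq'
    refine ⟨i % minimalPeriod σ u, Nat.mod_lt _ hpos, ?_⟩
    rw [iterate_mod_minimalPeriod_eq, ← hi, Equiv.Perm.iterate_eq_pow]
  · rintro ⟨i, -, rfl⟩
    have := (G.iterateWalk σ hσ i u).reachable
    exact (SimpleGraph.ConnectedComponent.sound this).symm.trans hc

/-- Links sums over the vertices of a loop, as they come from the determinant, with sums along a
traversal, as they define its homology class. -/
theorem SimpleGraph.sum_supp_eq_sum_range_iterate {M : Type*} [AddCommMonoid M] (G : SimpleGraph V)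
    (σ : Equiv.Perm V) (hσ : ∀ v, G.Adj v (σ v)) (hG : ∀ u v, G.Adj u v → σ u = v ∨ σ v = u)
    (c : G.ConnectedComponent) [DecidablePred (· ∈ c.supp)] {u : V} (hu : u ∈ c.supp) (g : V → M) :
    ∑ v with v ∈ c.supp, g v = ∑ i ∈ Finset.range (minimalPeriod σ u), g (σ^[i] u) := by
  rw [G.filter_mem_supp_eq_image_iterate σ hσ hG c hu, Finset.sum_image]
  intro i hi j hj hij
  exact iterate_injOn_Iio_minimalPeriod (by simpa using hi) (by simpa using hj) hij

theorem SimpleGraph.ncard_supp_eq_minimalPeriod (G : SimpleGraph V)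
    (σ : Equiv.Perm V) (hσ : ∀ v, G.Adj v (σ v)) (hG : ∀ u v, G.Adj u v → σ u = v ∨ σ v = u)
    (c : G.ConnectedComponent) {u : V} (hu : u ∈ c.supp) :
    c.supp.ncard = minimalPeriod σ u := by
  have := G.sum_supp_eq_sum_range_iterate σ hσ hG c hu (fun _ => 1)
  simp only [Finset.sum_const, smul_eq_mul, mul_one, Finset.card_range] at this
  rw [← this, ← Set.ncard_coe_finset, Finset.coe_filter_univ]
  rfl

end PermLoops

/-! ### Reversing a permutation on an invariant set -/

section Reversal

open scoped Classical

variable {V : Type*}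

/-- The permutation that agrees with `σ⁻¹` on the `σ`-invariant set `S` and with `σ` elsewhere. -/
noncomputable def Equiv.Perm.reverseOn (σ : Equiv.Perm V) (S : Set V) : Equiv.Perm V :=
  if h : ∀ v, σ v ∈ S ↔ v ∈ S then
    σ * (Equiv.Perm.ofSubtype (σ.subtypePerm h))⁻¹ * (Equiv.Perm.ofSubtype (σ.subtypePerm h))⁻¹
  -- With this default, the sign and the values outside `S` can be computed without assuming
  -- invariance.
  else σ

theorem Equiv.Perm.reverseOn_apply_apply {σ : Equiv.Perm V} {S : Set V}
    (h : ∀ v, σ v ∈ S ↔ v ∈ S) {v : V} (hv : v ∈ S) : σ.reverseOn S (σ v) = v := by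
  have h1 : ∀ w ∈ S, (Equiv.Perm.ofSubtype (σ.subtypePerm h))⁻¹ (σ w) = w := fun w hw => by
    rw [Equiv.Perm.inv_eq_iff_eq]
    exact (Equiv.Perm.ofSubtype_apply_of_mem (σ.subtypePerm h) hw).symm
  simp only [Equiv.Perm.reverseOn, dif_pos h, Equiv.Perm.mul_apply, h1 v hv]
  obtain ⟨x, rfl⟩ := σ.surjective v
  rw [h1 x ((h x).1 hv)]

theorem Equiv.Perm.reverseOn_apply_of_notMem {σ : Equiv.Perm V} {S : Set V} {v : V} (hv : v ∉ S) :
    σ.reverseOn S v = σ v := by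
  by_cases h : ∀ v, σ v ∈ S ↔ v ∈ S
  · have h1 : (Equiv.Perm.ofSubtype (σ.subtypePerm h))⁻¹ v = v := by
      rw [Equiv.Perm.inv_eq_iff_eq]
      exact (Equiv.Perm.ofSubtype_apply_of_not_mem (σ.subtypePerm h) hv).symm
    simp only [Equiv.Perm.reverseOn, dif_pos h, Equiv.Perm.mul_apply, h1]
  · simp only [Equiv.Perm.reverseOn, dif_neg h]

theorem Equiv.Perm.reverseOn_mem_iff {σ : Equiv.Perm V} {S : Set V}
    (h : ∀ v, σ v ∈ S ↔ v ∈ S) (v : V) : σ.reverseOn S v ∈ S ↔ v ∈ S := by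
  by_cases hv : v ∈ S
  · obtain ⟨x, rfl⟩ := σ.surjective v
    rw [Equiv.Perm.reverseOn_apply_apply h ((h x).1 hv), h]
  · rw [Equiv.Perm.reverseOn_apply_of_notMem hv, h]

theorem Equiv.Perm.reverseOn_reverseOn {σ : Equiv.Perm V} {S : Set V}
    (h : ∀ v, σ v ∈ S ↔ v ∈ S) : (σ.reverseOn S).reverseOn S = σ := by
  ext v
  by_cases hv : v ∈ S
  · conv_lhs => rw [← Equiv.Perm.reverseOn_apply_apply h hv]
    rw [Equiv.Perm.reverseOn_apply_apply (Equiv.Perm.reverseOn_mem_iff h) ((h v).2 hv)]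
  · rw [Equiv.Perm.reverseOn_apply_of_notMem hv, Equiv.Perm.reverseOn_apply_of_notMem hv]

/-- The inverse of the restriction to `S` enters twice, so its sign squares to 1. -/
theorem Equiv.Perm.sign_reverseOn [Fintype V] [DecidableEq V] (σ : Equiv.Perm V) (S : Set V) :
    Equiv.Perm.sign (σ.reverseOn S) = Equiv.Perm.sign σ := by
  unfold Equiv.Perm.reverseOn
  split_ifs with h
  · simp only [map_mul, mul_assoc, Int.units_mul_self, mul_one]
  · rfl

/-- Reversing `σ` on `S` amounts to replacing the steps `v ↦ σ v` with `v ∈ S` by `σ v ↦ v`. -/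
theorem Equiv.Perm.exists_reindex_reverseOn {σ : Equiv.Perm V} {S : Set V}
    (h : ∀ v, σ v ∈ S ↔ v ∈ S) :
    ∃ τ : Equiv.Perm V, (∀ v ∈ S, τ v = σ v ∧ σ.reverseOn S (τ v) = v) ∧
      ∀ v ∉ S, τ v = v ∧ σ.reverseOn S (τ v) = σ v := by
  refine ⟨Equiv.Perm.ofSubtype (σ.subtypePerm h), fun v hv => ?_, fun v hv => ?_⟩
  · have : Equiv.Perm.ofSubtype (σ.subtypePerm h) v = σ v :=
      Equiv.Perm.ofSubtype_apply_of_mem (σ.subtypePerm h) hv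
    exact ⟨this, by rw [this, Equiv.Perm.reverseOn_apply_apply h hv]⟩
  · have : Equiv.Perm.ofSubtype (σ.subtypePerm h) v = v :=
      Equiv.Perm.ofSubtype_apply_of_not_mem (σ.subtypePerm h) hv
    exact ⟨this, by rw [this, Equiv.Perm.reverseOn_apply_of_notMem hv]⟩

end Reversal

/-! ### Edges and their reference directions -/

section FisherEdges

open scoped Classical

variable {n m : ℕ}

namespace FisherEdge

/-- The Fisher graph has no multiple edges. -/
theorem eq_of_src_eq_of_dst_eq {e e' : FisherEdge n m} (hs : e.src = e'.src)
    (hd : e.dst = e'.dst) : e = e' := by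
  rcases e with ⟨p, ⟨s, k⟩ | k⟩ <;> rcases e' with ⟨p', ⟨s', k'⟩ | k'⟩ <;>
    simp only [src, dst, Prod.mk.injEq] at hs hd <;> grind

/-- Along a side of a triangle the corner grows by 1 modulo 3, and 2 ≠ 0 there; between triangles
the type goes from `false` to `true`. The size of the torus plays no role. -/
theorem not_src_eq_dst_and_dst_eq_src (e e' : FisherEdge n m) :
    ¬ (e.src = e'.dst ∧ e.dst = e'.src) := by
  rintro ⟨hs, hd⟩
  rcases e with ⟨p, ⟨s, k⟩ | k⟩ <;> rcases e' with ⟨p', ⟨s', k'⟩ | k'⟩ <;>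
    simp only [src, dst, Prod.mk.injEq] at hs hd <;> grind

theorem joins_src_dst_iff {e e' : FisherEdge n m} : e'.Joins e.src e.dst ↔ e' = e :=
  ⟨fun h => eq_of_src_eq_of_dst_eq h.1 h.2, fun h => h ▸ ⟨rfl, rfl⟩⟩

theorem not_joins_dst_src (e e' : FisherEdge n m) : ¬ e'.Joins e.dst e.src :=
  not_src_eq_dst_and_dst_eq_src e' e

/-- An edge is determined by its endpoints. -/
theorem eq_of_joins {e e' : FisherEdge n m} {u v : FisherVertex n m}
    (h : e.Joins u v ∨ e.Joins v u) (h' : e'.Joins u v ∨ e'.Joins v u) : e = e' := by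
  rcases h with ⟨rfl, rfl⟩ | ⟨rfl, rfl⟩
  · exact (joins_src_dst_iff.1 (h'.resolve_right (not_joins_dst_src e e'))).symm
  · exact (joins_src_dst_iff.1 (h'.resolve_left (not_joins_dst_src e e'))).symm

end FisherEdge

namespace FisherOrientation

theorem tail_head_eq_src_dst_iff (o : FisherOrientation) (e e' : FisherEdge n m) :
    (o.tail e' = e.src ∧ o.head e' = e.dst) ↔ e' = e ∧ o e.2 = true := by
  constructor
  · rintro ⟨ht, hh⟩
    cases h : o e'.2
    · simp only [tail, head, h] at ht hh
      exact absurd ⟨by simpa using hh, by simpa using ht⟩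
        (FisherEdge.not_src_eq_dst_and_dst_eq_src e' e)
    · simp only [tail, head, h, if_true] at ht hh
      obtain rfl := FisherEdge.eq_of_src_eq_of_dst_eq ht hh
      exact ⟨rfl, h⟩
  · rintro ⟨rfl, h⟩
    simp [tail, head, h]

theorem tail_head_eq_dst_src_iff (o : FisherOrientation) (e e' : FisherEdge n m) :
    (o.tail e' = e.dst ∧ o.head e' = e.src) ↔ e' = e ∧ o e.2 = false := by
  constructor
  · rintro ⟨ht, hh⟩
    cases h : o e'.2
    · simp only [tail, head, h] at ht hh
      obtain rfl := FisherEdge.eq_of_src_eq_of_dst_eq (e := e') (e' := e) (by simpa using hh)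
        (by simpa using ht)
      exact ⟨rfl, h⟩
    · simp only [tail, head, h, if_true] at ht hh
      exact absurd ⟨ht, hh⟩ (FisherEdge.not_src_eq_dst_and_dst_eq_src e' e)
  · rintro ⟨rfl, h⟩
    simp [tail, head, h]

/-- The sign of an orientation on an edge class, relative to the reference direction. -/
def sign (o : FisherOrientation) (k : FisherEdgeClass) : ℤ := if o k then 1 else -1

end FisherOrientation

/-! ### Matrix entries, crossing numbers and face boundaries -/

section Kasteleyn

theorem stepChain_swap (u v : FisherVertex n m) : stepChain v u = -stepChain u v := by
  ext e
  simp [stepChain]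

/-- All edges crossed by γ_x lie in one translation class, so a translation-invariant orientation
directs them alike. Hence the exponent of `z` is a fixed sign times a crossing number, which is
linear in the chain. -/
theorem FisherOrientation.ite_crossesX (o : FisherOrientation) (e : FisherEdge n m) :
    (if e.CrossesX then o.sign e.2 else 0) = o.sign (Sum.inr 1) * if e.CrossesX then 1 else 0 := by
  split_ifs with h
  · rw [h.1, mul_one]
  · rw [mul_zero]

theorem FisherOrientation.ite_crossesY (o : FisherOrientation) (e : FisherEdge n m) :
    (if e.CrossesY then o.sign e.2 else 0) = o.sign (Sum.inr 2) * if e.CrossesY then 1 else 0 := by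
  split_ifs with h
  · rw [h.1, mul_one]
  · rw [mul_zero]

variable [NeZero n] [NeZero m]

theorem kasteleyn_src_dst (o : FisherOrientation) (W : FisherEdge n m → ℝ) (e : FisherEdge n m) :
    kasteleyn o W e.src e.dst = Laurent2.monomial (if e.CrossesX then o.sign e.2 else 0)
      (if e.CrossesY then o.sign e.2 else 0) (o.sign e.2 * W e) := by
  simp only [kasteleyn, FisherOrientation.tail_head_eq_src_dst_iff,
    FisherOrientation.tail_head_eq_dst_src_iff]
  cases h : o e.2 <;> simp [FisherOrientation.sign, h]

theorem kasteleyn_dst_src (o : FisherOrientation) (W : FisherEdge n m → ℝ) (e : FisherEdge n m) :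
    kasteleyn o W e.dst e.src = Laurent2.monomial (if e.CrossesX then -o.sign e.2 else 0)
      (if e.CrossesY then -o.sign e.2 else 0) (-(o.sign e.2 * W e)) := by
  simp only [kasteleyn, FisherOrientation.tail_head_eq_src_dst_iff,
    FisherOrientation.tail_head_eq_dst_src_iff]
  cases h : o e.2 <;> simp [FisherOrientation.sign, h]

theorem exists_joins_of_kasteleyn_ne_zero {o : FisherOrientation} {W : FisherEdge n m → ℝ}
    {u v : FisherVertex n m} (h : kasteleyn o W u v ≠ 0) :
    ∃ e : FisherEdge n m, e.Joins u v ∨ e.Joins v u := by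
  by_contra! hne
  have hne' : ∀ e : FisherEdge n m, ¬ (o.tail e = u ∧ o.head e = v) ∧
      ¬ (o.tail e = v ∧ o.head e = u) := fun e => by
    have h1 := hne e
    simp only [FisherEdge.Joins] at h1
    cases ho : o e.2 <;> simp only [FisherOrientation.tail, FisherOrientation.head, ho, if_true,
      Bool.false_eq_true, if_false] <;> tauto
  refine h ?_
  rw [kasteleyn, Finset.sum_eq_zero fun e _ => if_neg (hne' e).1,
    Finset.sum_eq_zero fun e _ => if_neg (hne' e).2, add_zero]

/-- The algebraic number of times that a `1`-chain uses the edges with property `P`. -/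
noncomputable def crossingNumber (P : FisherEdge n m → Prop) :
    (FisherEdge n m → ℤ) →ₗ[ℤ] ℤ := ∑ e with P e, LinearMap.proj e

theorem crossingNumber_apply (P : FisherEdge n m → Prop) (c : FisherEdge n m → ℤ) :
    crossingNumber P c = ∑ e, if P e then c e else 0 := by
  simp only [crossingNumber, LinearMap.sum_apply, LinearMap.proj_apply]
  rw [Finset.sum_filter]

theorem crossingNumber_stepChain_src_dst (P : FisherEdge n m → Prop) (e : FisherEdge n m) :
    crossingNumber P (stepChain e.src e.dst) = if P e then 1 else 0 := by
  have h : ∀ e', (if P e' then stepChain e.src e.dst e' else 0) =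
      if e' = e then (if P e then 1 else 0) else 0 := fun e' => by
    simp only [stepChain, FisherEdge.joins_src_dst_iff, FisherEdge.not_joins_dst_src, if_false,
      sub_zero]
    split_ifs <;> simp_all
  simp only [crossingNumber_apply, h, Finset.sum_ite_eq', Finset.mem_univ, if_true]

theorem crossingNumber_stepChain_dst_src (P : FisherEdge n m → Prop) (e : FisherEdge n m) :
    crossingNumber P (stepChain e.dst e.src) = -if P e then 1 else 0 := by
  rw [stepChain_swap, map_neg, crossingNumber_stepChain_src_dst]

/-- The exponents of `z` and `w` that a `1`-chain acquires in products of entries of `K(z, w)`. -/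
noncomputable def kasteleynDegree (o : FisherOrientation) (c : FisherEdge n m → ℤ) : ℤ × ℤ :=
  (o.sign (Sum.inr 1) * crossingNumber FisherEdge.CrossesX c,
    o.sign (Sum.inr 2) * crossingNumber FisherEdge.CrossesY c)

/-- Reversing a step changes the sign of the entry and inverts its monomial. -/
theorem kasteleyn_swap (o : FisherOrientation) (W : FisherEdge n m → ℝ) (u v : FisherVertex n m) :
    kasteleyn o W v u =
      AddMonoidAlgebra.single (-(2 : ℤ) • kasteleynDegree o (stepChain u v)) (-1 : ℝ) *
        kasteleyn o W u v := by
  have hneg : ∀ (P : Prop) (a : ℤ), (if P then -a else 0) = -if P then a else 0 := fun P a => by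
    split_ifs <;> simp
  by_cases h : ∃ e : FisherEdge n m, e.Joins u v ∨ e.Joins v u
  · obtain ⟨e, ⟨rfl, rfl⟩ | ⟨rfl, rfl⟩⟩ := h
    · rw [kasteleyn_src_dst, kasteleyn_dst_src, kasteleynDegree, hneg, hneg,
        crossingNumber_stepChain_src_dst, crossingNumber_stepChain_src_dst, o.ite_crossesX,
        o.ite_crossesY, Laurent2.monomial, Laurent2.monomial, AddMonoidAlgebra.single_mul_single]
      congr 1
      · ext <;> simp only [Prod.fst_add, Prod.snd_add, Prod.smul_fst, Prod.smul_snd, smul_eq_mul] <;> ring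
      · ring
    · rw [kasteleyn_src_dst, kasteleyn_dst_src, kasteleynDegree, hneg, hneg,
        crossingNumber_stepChain_dst_src, crossingNumber_stepChain_dst_src, o.ite_crossesX,
        o.ite_crossesY, Laurent2.monomial, Laurent2.monomial, AddMonoidAlgebra.single_mul_single]
      congr 1
      · ext <;> simp only [Prod.fst_add, Prod.snd_add, Prod.smul_fst, Prod.smul_snd, smul_eq_mul] <;> ring
      · ring
  · have h1 : kasteleyn o W u v = 0 := by
      by_contra h1
      exact h (exists_joins_of_kasteleyn_ne_zero h1)
    have h2 : kasteleyn o W v u = 0 := by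
      by_contra h2
      obtain ⟨e, he⟩ := exists_joins_of_kasteleyn_ne_zero h2
      exact h ⟨e, he.symm⟩
    rw [h1, h2, mul_zero]

theorem crossingNumber_stepChain_of_joins (P : FisherEdge n m → Prop) {u v : FisherVertex n m}
    (e : FisherEdge n m) (h : e.Joins u v) :
    crossingNumber P (stepChain u v) = if P e then 1 else 0 := by
  obtain ⟨rfl, rfl⟩ := h
  exact crossingNumber_stepChain_src_dst P e

theorem crossingNumber_stepChain_of_joins_symm (P : FisherEdge n m → Prop)
    {u v : FisherVertex n m} (e : FisherEdge n m) (h : e.Joins v u) :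
    crossingNumber P (stepChain u v) = -if P e then 1 else 0 := by
  obtain ⟨rfl, rfl⟩ := h
  exact crossingNumber_stepChain_dst_src P e

/-- The boundary of a face has crossing number zero with a family of edges that contains no sides
of triangles and no `a`-edges, and whose `b`-edges (`c`-edges) are invariant under translation in
the second (first) direction. -/
theorem crossingNumber_circuit_eq_zero (P : FisherEdge n m → Prop)
    (ht : ∀ p t, ¬ P (p, Sum.inl t)) (ha : ∀ p, ¬ P (p, Sum.inr 0))
    (hb : ∀ x y, P ((x, y), Sum.inr 1) ↔ P ((x, y + 1), Sum.inr 1))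
    (hc : ∀ x y, P ((x, y), Sum.inr 2) ↔ P ((x + 1, y), Sum.inr 2)) (F : FisherFace n m) :
    crossingNumber P (pathChain F.circuit) = 0 := by
  rcases F with ⟨⟨x, y⟩, _ | s⟩
  · simp only [pathChain, FisherFace.circuit, List.tail_cons, List.zip_cons_cons, List.zip_nil_right,
      List.map_cons, List.map_nil, List.sum_cons, List.sum_nil, map_add, map_zero]
    rw [crossingNumber_stepChain_of_joins P (u := ((x, y), false, 1))
        (v := ((x + 1, y), true, 1)) ((x, y), Sum.inr 1) ⟨rfl, rfl⟩,
      crossingNumber_stepChain_of_joins_symm P (u := ((x + 1, y), true, 1))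
        (v := ((x + 1, y), true, 0)) ((x + 1, y), Sum.inl (true, 0)) ⟨rfl, rfl⟩,
      crossingNumber_stepChain_of_joins_symm P (u := ((x + 1, y), true, 0))
        (v := ((x + 1, y), false, 0)) ((x + 1, y), Sum.inr 0) ⟨rfl, rfl⟩,
      crossingNumber_stepChain_of_joins_symm P (u := ((x + 1, y), false, 0))
        (v := ((x + 1, y), false, 2)) ((x + 1, y), Sum.inl (false, 2)) ⟨rfl, rfl⟩,
      crossingNumber_stepChain_of_joins P (u := ((x + 1, y), false, 2))
        (v := ((x + 1, y + 1), true, 2)) ((x + 1, y), Sum.inr 2) ⟨rfl, rfl⟩,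
      crossingNumber_stepChain_of_joins_symm P (u := ((x + 1, y + 1), true, 2))
        (v := ((x + 1, y + 1), true, 1)) ((x + 1, y + 1), Sum.inl (true, 1)) ⟨rfl, rfl⟩,
      crossingNumber_stepChain_of_joins_symm P (u := ((x + 1, y + 1), true, 1))
        (v := ((x, y + 1), false, 1)) ((x, y + 1), Sum.inr 1) ⟨rfl, rfl⟩,
      crossingNumber_stepChain_of_joins_symm P (u := ((x, y + 1), false, 1))
        (v := ((x, y + 1), false, 0)) ((x, y + 1), Sum.inl (false, 0)) ⟨rfl, rfl⟩,
      crossingNumber_stepChain_of_joins P (u := ((x, y + 1), false, 0))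
        (v := ((x, y + 1), true, 0)) ((x, y + 1), Sum.inr 0) ⟨rfl, rfl⟩,
      crossingNumber_stepChain_of_joins_symm P (u := ((x, y + 1), true, 0))
        (v := ((x, y + 1), true, 2)) ((x, y + 1), Sum.inl (true, 2)) ⟨rfl, rfl⟩,
      crossingNumber_stepChain_of_joins_symm P (u := ((x, y + 1), true, 2))
        (v := ((x, y), false, 2)) ((x, y), Sum.inr 2) ⟨rfl, rfl⟩,
      crossingNumber_stepChain_of_joins_symm P (u := ((x, y), false, 2))
        (v := ((x, y), false, 1)) ((x, y), Sum.inl (false, 1)) ⟨rfl, rfl⟩]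
    -- The two `b`-edges of the dodecagon are translates of each other traversed in opposite
    -- directions, and so are its two `c`-edges; their contributions cancel.
    simp only [ht, ha, ← hb, ← hc, if_false]
    ring
  · simp only [pathChain, FisherFace.circuit, List.tail_cons, List.zip_cons_cons, List.zip_nil_right,
      List.map_cons, List.map_nil, List.sum_cons, List.sum_nil, map_add, map_zero]
    rw [crossingNumber_stepChain_of_joins P (u := ((x, y), s, 0))
        (v := ((x, y), s, 1)) ((x, y), Sum.inl (s, 0)) ⟨rfl, rfl⟩,
      crossingNumber_stepChain_of_joins P (u := ((x, y), s, 1))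
        (v := ((x, y), s, 2)) ((x, y), Sum.inl (s, 1)) ⟨rfl, rfl⟩,
      crossingNumber_stepChain_of_joins P (u := ((x, y), s, 2))
        (v := ((x, y), s, 0)) ((x, y), Sum.inl (s, 2)) ⟨rfl, rfl⟩]
    simp only [ht, if_false, add_zero]

/-- Boundaries have degree zero. -/
theorem kasteleynDegree_faceBoundary (o : FisherOrientation) (f : FisherFace n m → ℤ) :
    kasteleynDegree o (faceBoundary f) = 0 := by
  have hX : ∀ F : FisherFace n m,
      crossingNumber FisherEdge.CrossesX (pathChain F.circuit) = 0 :=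
    crossingNumber_circuit_eq_zero _ (by simp [FisherEdge.CrossesX]) (by simp [FisherEdge.CrossesX])
      (by simp [FisherEdge.CrossesX]) (by simp [FisherEdge.CrossesX])
  have hY : ∀ F : FisherFace n m,
      crossingNumber FisherEdge.CrossesY (pathChain F.circuit) = 0 :=
    crossingNumber_circuit_eq_zero _ (by simp [FisherEdge.CrossesY]) (by simp [FisherEdge.CrossesY])
      (by simp [FisherEdge.CrossesY]) (by simp [FisherEdge.CrossesY])
  simp [kasteleynDegree, faceBoundary, map_sum, hX, hY, -zsmul_eq_mul]

theorem kasteleynDegree_sum {ι : Type*} (o : FisherOrientation) (s : Finset ι)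
    (c : ι → FisherEdge n m → ℤ) :
    kasteleynDegree o (∑ i ∈ s, c i) = ∑ i ∈ s, kasteleynDegree o (c i) := by
  ext <;> simp [kasteleynDegree, Prod.fst_sum, Prod.snd_sum, Finset.mul_sum]

end Kasteleyn

end FisherEdges

/-! ### Expansion over loop configurations and cancellation -/

section Loops

open scoped Classical
open Function

variable {n m : ℕ}

theorem pathChain_cons_cons (a b : FisherVertex n m) (l : List (FisherVertex n m)) :
    pathChain (a :: b :: l) = stepChain a b + pathChain (b :: l) := by
  simp [pathChain]

theorem pathChain_iterate (f : FisherVertex n m → FisherVertex n m) (i : ℕ)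
    (u : FisherVertex n m) :
    pathChain ((List.range (i + 1)).map fun j => f^[j] u) =
      ∑ j ∈ Finset.range i, stepChain (f^[j] u) (f (f^[j] u)) := by
  induction i generalizing u with
  | zero => simp [pathChain]
  | succ i ih =>
    have h := ih (f u)
    rw [Finset.sum_range_succ', add_comm (∑ _ ∈ _, _), List.range_succ_eq_map]
    rw [List.range_succ_eq_map] at h ⊢
    simp only [List.map_cons, List.map_map, pathChain_cons_cons, iterate_zero, id] at h ⊢
    simp only [iterate_succ_apply] at h ⊢
    rw [← h]
    rfl

variable [NeZero n] [NeZero m]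

theorem stepCount_ne_zero {σ : Equiv.Perm (FisherVertex n m)} {e : FisherEdge n m} :
    stepCount σ e ≠ 0 ↔ ∃ v, e.Joins v (σ v) ∨ e.Joins (σ v) v := by
  rw [stepCount, ← Nat.pos_iff_ne_zero, Finset.card_pos, Finset.Nonempty]
  simp only [Finset.mem_filter, Finset.mem_univ, true_and]

/-- The steps of a permutation along edges occupy each vertex twice: once by the step that leaves
it, and once by the step that arrives there. -/
theorem sum_stepCount_eq_two {σ : Equiv.Perm (FisherVertex n m)}
    (h : ∀ v, ∃ e : FisherEdge n m, e.Joins v (σ v) ∨ e.Joins (σ v) v) (u : FisherVertex n m) :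
    (∑ e : FisherEdge n m, if e.src = u ∨ e.dst = u then stepCount σ e else 0) = 2 := by
  choose E hE using h
  have hcount : ∀ e, stepCount σ e = ∑ v, if e = E v then 1 else 0 := fun e => by
    rw [stepCount, Finset.card_filter]
    refine Finset.sum_congr rfl fun v _ => if_congr ?_ rfl rfl
    exact ⟨fun he => FisherEdge.eq_of_joins he (hE v), fun he => he ▸ hE v⟩
  have hend : ∀ v, ((E v).src = u ∨ (E v).dst = u) ↔ v = u ∨ v = σ.symm u := fun v => by
    rw [Equiv.eq_symm_apply]
    rcases hE v with ⟨h1, h2⟩ | ⟨h1, h2⟩ <;> rw [h1, h2]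
    exact or_comm
  -- The steps leaving and entering `u` count separately even if they use the same edge, which then
  -- has multiplicity 2. They coincide only at a fixed point, excluded because no edge has equal
  -- endpoints.
  have hne : u ≠ σ.symm u := fun hu => by
    rw [Equiv.eq_symm_apply] at hu
    rcases hE u with ⟨h1, h2⟩ | ⟨h1, h2⟩
    · exact (E u).src_ne_dst (h1.trans (hu.symm.trans h2.symm))
    · exact (E u).src_ne_dst (h1.trans (hu.trans h2.symm))
  calc (∑ e : FisherEdge n m, if e.src = u ∨ e.dst = u then stepCount σ e else 0)
      = ∑ e : FisherEdge n m, ∑ v, if e = E v then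
          (if (E v).src = u ∨ (E v).dst = u then 1 else 0) else 0 := by
        refine Finset.sum_congr rfl fun e _ => ?_
        rw [hcount]
        split_ifs with he
        · refine Finset.sum_congr rfl fun v _ => ?_
          split_ifs <;> simp_all
        · refine (Finset.sum_eq_zero fun v _ => ?_).symm
          split_ifs <;> simp_all
    _ = ∑ v, if v = u ∨ v = σ.symm u then 1 else 0 := by
        rw [Finset.sum_comm]
        refine Finset.sum_congr rfl fun v _ => ?_
        rw [Finset.sum_ite_eq', if_pos (Finset.mem_univ _)]
        exact if_congr (hend v) rfl rfl
    _ = 2 := by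
        rw [← Finset.card_filter, ← Finset.card_pair hne]
        congr 1
        ext v
        simp

/-- The term of a permutation in the expansion of `det K(z, w)`. -/
noncomputable def kasteleynTerm (o : FisherOrientation) (W : FisherEdge n m → ℝ)
    (σ : Equiv.Perm (FisherVertex n m)) : Laurent2 :=
  (Equiv.Perm.sign σ : ℤ) • ∏ v, kasteleyn o W v (σ v)

theorem exists_joins_of_kasteleynTerm_ne_zero {o : FisherOrientation} {W : FisherEdge n m → ℝ}
    {σ : Equiv.Perm (FisherVertex n m)} (h : kasteleynTerm o W σ ≠ 0) (v : FisherVertex n m) :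
    ∃ e : FisherEdge n m, e.Joins v (σ v) ∨ e.Joins (σ v) v := by
  refine exists_joins_of_kasteleyn_ne_zero (o := o) (W := W) fun hv => h ?_
  rw [kasteleynTerm, Finset.prod_eq_zero (Finset.mem_univ v) hv, smul_zero]

theorem fisherCharPoly_eq_sum_kasteleynTerm (o : FisherOrientation) (W : FisherEdge n m → ℝ) :
    fisherCharPoly o W = ∑ σ, kasteleynTerm o W σ := by
  -- `Matrix.det_apply` uses the entries `M (σ v) v`; transposing gives `M v (σ v)`.
  rw [fisherCharPoly, ← Matrix.det_transpose, Matrix.det_apply]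
  exact Finset.sum_congr rfl fun σ _ => rfl

theorem fisherCharPoly_eq_sum_contribution (o : FisherOrientation) (W : FisherEdge n m → ℝ) :
    fisherCharPoly o W = ∑ C : LoopConfig n m, C.contribution o W := by
  rw [fisherCharPoly_eq_sum_kasteleynTerm]
  simp only [LoopConfig.contribution]
  rw [Finset.sum_comm]
  refine Finset.sum_congr rfl fun σ _ => ?_
  change _ = ∑ C : LoopConfig n m, if stepCount σ = C.mult then kasteleynTerm o W σ else 0
  by_cases h : kasteleynTerm o W σ = 0
  · simp [h]
  -- Only a nonzero term guarantees that the step counts form a configuration; zero terms are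
  -- harmless on both sides.
  · let D : LoopConfig n m :=
      ⟨stepCount σ, sum_stepCount_eq_two (exists_joins_of_kasteleynTerm_ne_zero h)⟩
    have hD : ∀ C : LoopConfig n m, stepCount σ = C.mult ↔ D = C := fun C =>
      (LoopConfig.ext_iff (x := D) (y := C)).symm
    simp only [hD, Finset.sum_ite_eq, Finset.mem_univ, if_true]

namespace LoopConfig

variable {C : LoopConfig n m} {σ : Equiv.Perm (FisherVertex n m)}

theorem graph_adj_apply (hC : stepCount σ = C.mult)
    (h : ∀ v, ∃ e : FisherEdge n m, e.Joins v (σ v) ∨ e.Joins (σ v) v) (v : FisherVertex n m) :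
    C.graph.Adj v (σ v) := by
  obtain ⟨e, he⟩ := h v
  exact ⟨e, hC ▸ stepCount_ne_zero.2 ⟨v, he⟩, he⟩

theorem apply_eq_of_graph_adj (hC : stepCount σ = C.mult) (u v : FisherVertex n m)
    (h : C.graph.Adj u v) : σ u = v ∨ σ v = u := by
  obtain ⟨e, he, huv⟩ := h
  obtain ⟨w, hw⟩ := stepCount_ne_zero.1 (hC ▸ he)
  rcases huv with ⟨h1, h2⟩ | ⟨h1, h2⟩ <;> rcases hw with ⟨h3, h4⟩ | ⟨h3, h4⟩ <;> grind

/-- On a homologically trivial odd loop, the steps of each orientation have total degree zero. -/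
theorem sum_kasteleynDegree_eq_zero (o : FisherOrientation) (hC : stepCount σ = C.mult)
    (h : ∀ v, ∃ e : FisherEdge n m, e.Joins v (σ v) ∨ e.Joins (σ v) v) {c : C.Loop}
    (hodd : Odd c.supp.ncard) (htriv : ¬ C.HomologicallyNontrivial c) :
    ∑ v with v ∈ c.supp, kasteleynDegree o (stepChain v (σ v)) = 0 := by
  have hσ := graph_adj_apply hC h
  have hG := apply_eq_of_graph_adj hC
  obtain ⟨u, hu⟩ := c.nonempty_supp
  have hk := C.graph.ncard_supp_eq_minimalPeriod σ hσ hG c hu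
  -- There are no fixed points, and an odd period is not 2.
  have h3 : 3 ≤ minimalPeriod σ u := by
    have h1 : minimalPeriod σ u ≠ 1 := fun h1 =>
      (hσ u).ne (minimalPeriod_eq_one_iff_isFixedPt.1 h1).symm
    rw [hk] at hodd
    obtain ⟨j, hj⟩ := hodd
    omega
  have hcycle := C.graph.isCycle_iterateWalk σ hσ u h3
  -- Triviality makes every cycle in the loop a boundary, in particular the one traced by `σ`.
  obtain ⟨f, hf⟩ := by_contra fun hf => htriv ⟨u, _, hu, hcycle, hf⟩
  rw [SimpleGraph.Walk.support_copy, SimpleGraph.support_iterateWalk, pathChain_iterate] at hf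
  rw [C.graph.sum_supp_eq_sum_range_iterate σ hσ hG c hu, ← kasteleynDegree_sum, ← hf,
    kasteleynDegree_faceBoundary]

end LoopConfig

/-- Reversal of a permutation on an invariant set does not change the underlying loop
configuration. -/
theorem stepCount_reverseOn {σ : Equiv.Perm (FisherVertex n m)} {S : Set (FisherVertex n m)}
    (h : ∀ v, σ v ∈ S ↔ v ∈ S) : stepCount (σ.reverseOn S) = stepCount σ := by
  obtain ⟨τ, hS, hS'⟩ := Equiv.Perm.exists_reindex_reverseOn h
  ext e
  refine (Finset.card_equiv τ fun v => ?_).symm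
  simp only [Finset.mem_filter, Finset.mem_univ, true_and]
  by_cases hv : v ∈ S
  · rw [(hS v hv).2, (hS v hv).1, or_comm]
  · rw [(hS' v hv).2, (hS' v hv).1]

/-- Reversal on an invariant set of odd cardinality and degree zero changes the sign of the term. -/
theorem kasteleynTerm_reverseOn (o : FisherOrientation) (W : FisherEdge n m → ℝ)
    {σ : Equiv.Perm (FisherVertex n m)} {S : Set (FisherVertex n m)}
    [DecidablePred (· ∈ S)] (h : ∀ v, σ v ∈ S ↔ v ∈ S) (hodd : Odd S.ncard)
    (hdeg : ∑ v with v ∈ S, kasteleynDegree o (stepChain v (σ v)) = 0) :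
    kasteleynTerm o W (σ.reverseOn S) = -kasteleynTerm o W σ := by
  obtain ⟨τ, hS, hS'⟩ := Equiv.Perm.exists_reindex_reverseOn h
  have hcard : Odd (Finset.univ.filter fun v => v ∈ S).card := by
    rw [← Set.ncard_coe_finset, Finset.coe_filter_univ]
    exact hodd
  have hprod : ∏ v, kasteleyn o W v (σ.reverseOn S v) = -∏ v, kasteleyn o W v (σ v) := by
    rw [← Equiv.prod_comp τ, ← Finset.prod_filter_mul_prod_filter_not Finset.univ (· ∈ S),
      ← Finset.prod_filter_mul_prod_filter_not Finset.univ (· ∈ S)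
        (fun v => kasteleyn o W v (σ v)), ← neg_mul]
    congr 1
    · rw [Finset.prod_congr rfl fun v hv => by
        rw [(hS v (Finset.mem_filter.1 hv).2).2, (hS v (Finset.mem_filter.1 hv).2).1,
          kasteleyn_swap]]
      -- The monomials from the swaps multiply to degree zero by `hdeg`; what remains is (-1)^|S| =
      -- -1.
      rw [Finset.prod_mul_distrib, AddMonoidAlgebra.prod_single, ← Finset.smul_sum, hdeg, smul_zero,
        Finset.prod_const, hcard.neg_one_pow, AddMonoidAlgebra.single_neg,
        ← AddMonoidAlgebra.one_def, neg_one_mul]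
    · refine Finset.prod_congr rfl fun v hv => ?_
      rw [(hS' v (Finset.mem_filter.1 hv).2).2, (hS' v (Finset.mem_filter.1 hv).2).1]
  rw [kasteleynTerm, hprod, Equiv.Perm.sign_reverseOn, smul_neg, kasteleynTerm]

namespace LoopConfig

/-- A configuration with a homologically trivial odd loop cancels. -/
theorem contribution_eq_zero {C : LoopConfig n m} (o : FisherOrientation) (W : FisherEdge n m → ℝ)
    {c : C.Loop} (hodd : Odd c.supp.ncard) (htriv : ¬ C.HomologicallyNontrivial c) :
    C.contribution o W = 0 := by
  have key : ∀ σ ∈ Finset.univ.filter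
      (fun σ => stepCount σ = C.mult ∧ kasteleynTerm o W σ ≠ 0),
      stepCount σ = C.mult ∧ (∀ v, σ v ∈ c.supp ↔ v ∈ c.supp) ∧ kasteleynTerm o W σ ≠ 0 ∧
        kasteleynTerm o W (σ.reverseOn c.supp) = -kasteleynTerm o W σ := fun σ hσ => by
    obtain ⟨hC, h0⟩ := (Finset.mem_filter.1 hσ).2
    have hj := exists_joins_of_kasteleynTerm_ne_zero h0
    have hinv : ∀ v, σ v ∈ c.supp ↔ v ∈ c.supp := fun v =>
      (SimpleGraph.ConnectedComponent.mem_supp_congr_adj c (graph_adj_apply hC hj v)).symm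
    exact ⟨hC, hinv, h0, kasteleynTerm_reverseOn o W hinv hodd
      (sum_kasteleynDegree_eq_zero o hC hj hodd htriv)⟩
  -- Only nonzero terms are kept: their steps are edges, so the loop is invariant under `σ`, and a
  -- fixed point of the involution would contradict nonvanishing.
  have hsum : C.contribution o W =
      ∑ σ with stepCount σ = C.mult ∧ kasteleynTerm o W σ ≠ 0, kasteleynTerm o W σ := by
    rw [Finset.sum_filter]
    refine Finset.sum_congr rfl fun σ _ => ?_
    change (if stepCount σ = C.mult then kasteleynTerm o W σ else 0) = _
    split_ifs <;> simp_all
  rw [hsum]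
  refine Finset.sum_involution (fun σ _ => σ.reverseOn c.supp) (fun σ hσ => ?_) (fun σ hσ h0 he => ?_)
    (fun σ hσ => ?_) (fun σ hσ => ?_)
  · rw [(key σ hσ).2.2.2, add_neg_cancel]
  · have h := (key σ hσ).2.2.2
    -- A permutation equal to its reversal would have a term t with 2t = 0, hence t = 0 over ℝ.
    rw [he, eq_neg_iff_add_eq_zero, ← two_smul ℝ] at h
    rw [← one_smul ℝ (kasteleynTerm o W σ), ← inv_mul_cancel₀ (two_ne_zero' ℝ), mul_smul, h,
      smul_zero] at h0
    exact h0 rfl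
  · obtain ⟨hC, hinv, h0, hneg⟩ := key σ hσ
    refine Finset.mem_filter.2 ⟨Finset.mem_univ _, (stepCount_reverseOn hinv).trans hC, ?_⟩
    rw [hneg]
    exact neg_ne_zero.2 h0
  · exact Equiv.Perm.reverseOn_reverseOn (key σ hσ).2.1

/-- The components partition the vertices, so an odd number of odd ones would make 6mn odd. -/
theorem even_ncard_odd_loops (C : LoopConfig n m) :
    Even {c : C.Loop | Odd c.supp.ncard}.ncard := by
  refine Nat.not_odd_iff_even.1 fun h => ?_
  have := C.graph.odd_ncard_oddComponents.1 h
  rw [Nat.card_prod, Nat.card_prod Bool, Nat.card_eq_fintype_card (α := Bool),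
    Fintype.card_bool] at this
  exact absurd this (Nat.not_odd_iff_even.2 ⟨Nat.card (FisherCell n m) * Nat.card (Fin 3), by ring⟩)

end LoopConfig

end Loops

theorem mainTheorem10 (m n : ℕ) [NeZero m] [NeZero n]
    (o : FisherOrientation) (W : FisherEdge n m → ℝ) (hW : ∀ e, 0 < W e) :
    fisherCharPoly o W = ∑ C : LoopConfig n m, C.contribution o W ∧
    ∀ C : LoopConfig n m, C.contribution o W ≠ 0 →
      (∀ c : C.Loop, Odd c.supp.ncard → C.HomologicallyNontrivial c) ∧
      Even {c : C.Loop | Odd c.supp.ncard}.ncard := by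
  refine ⟨fisherCharPoly_eq_sum_contribution o W,
    fun C hC => ⟨fun c hc => ?_, C.even_ncard_odd_loops⟩⟩
  by_contra h
  exact hC (C.contribution_eq_zero o W hc h)
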